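/- Let $\mathbb F=\mathbb C(x,y)$ be the skew field of rational functions in two non-commuting variables $x,y$ (the universal skew field of fractions of the free algebra $\mathbb C\langle x,y\rangle$), and let $C=xyx^{-1}y^{-1}$. A Laurent polynomial with non-negative integer coefficients in invertible elements $u,v$ is a finite linear combination, with coefficients in $\mathbb Z_{\ge 0}$, of words in $u,v,u^{-1},v^{-1}$. Let $(b,c)=(1,4)$ or $(b,c)=(4,1)$, and consider the recursion for sequences $(R_n)_{n\in\mathbb Z}$ in $\mathbb F$ $$R_{n+1}\,C\,R_{n-1}=\begin{cases}1+R_n^{\,b}, & n \text{ odd},\\ 1+R_n^{\,c}, & n\text{ even}.\end{cases}$$ 1. Let $m\in\{0,1\}$. There is exactly one solution $(R_n)_{n\in\mathbb Z}$ in $\mathbb F$ with initial data $CR_m=x$, $R_{m+1}=y$, and all its terms are invertible. For every $n\in\mathbb Z$, the term $R_n$ is a Laurent polynomial with non-negative integer coefficients in the initial data $(x,y)$. Moreover, in each of these two solutions every $R_n$, $n\in\mathbb Z$, is such a Laurent polynomial both in $(CR_0,R_1)$ and in $(CR_1,R_2)$. 2. Let $T_a(u,v)=\big(uvu^{-1},\,(1+v^a)u^{-1}\big)$.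 For every $k\ge 0$ the vector $(T_cT_b)^k(x,y)$ is well defined (all inverses that occur exist), and both of its entries are Laurent polynomials in $x,y$ with non-negative integer coefficients. -/

import Mathlib

/-! ## The free skew field `ℂ(x, y)` in two non-commuting variables -/

/-- Non-commutative polynomials `ℂ⟨x, y⟩`. -/
abbrev NCPoly : Type := FreeAlgebra ℂ (Fin 2)

/-- A square matrix `A` of size `n` over a (non-commutative) ring is *full* if it cannot be written
as a product of an `n × r` matrix and an `r × n` matrix with `r < n`. -/
def IsFullMatrix {S : Type*} [Ring S] {n : ℕ} (A : Matrix (Fin n) (Fin n) S) : Prop :=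
  ∀ (r : ℕ) (P : Matrix (Fin n) (Fin r) S) (Q : Matrix (Fin r) (Fin n) S), A = P * Q → n ≤ r

namespace FreeSkewField

/-- Generators of the free skew field: the two variables, and the entries of a formal inverse
of every full matrix over `ℂ⟨x, y⟩`. -/
inductive Gen : Type
  | var (i : Fin 2) : Gen
  | inv (n : ℕ) (A : Matrix (Fin n) (Fin n) NCPoly) (hA : IsFullMatrix A) (i j : Fin n) : Gen

/-- The map from `ℂ⟨x, y⟩` to the free algebra on all the generators. -/
noncomputable def polyToFree : NCPoly →ₐ[ℂ] FreeAlgebra ℂ Gen :=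
  FreeAlgebra.lift ℂ (fun i => FreeAlgebra.ι ℂ (Gen.var i))

/-- The matrix of formal symbols that is to become the inverse of `A`. -/
noncomputable def formalInv {n : ℕ} (A : Matrix (Fin n) (Fin n) NCPoly) (hA : IsFullMatrix A) :
    Matrix (Fin n) (Fin n) (FreeAlgebra ℂ Gen) :=
  Matrix.of fun i j => FreeAlgebra.ι ℂ (Gen.inv n A hA i j)

/-- The defining relations: the formal inverse of a full matrix is a two-sided inverse. -/
inductive Rel : FreeAlgebra ℂ Gen → FreeAlgebra ℂ Gen → Prop
  | mul_inv {n : ℕ} (A : Matrix (Fin n) (Fin n) NCPoly) (hA : IsFullMatrix A) (i j : Fin n) :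
      Rel ((A.map polyToFree * formalInv A hA) i j)
        ((1 : Matrix (Fin n) (Fin n) (FreeAlgebra ℂ Gen)) i j)
  | inv_mul {n : ℕ} (A : Matrix (Fin n) (Fin n) NCPoly) (hA : IsFullMatrix A) (i j : Fin n) :
      Rel ((formalInv A hA * A.map polyToFree) i j)
        ((1 : Matrix (Fin n) (Fin n) (FreeAlgebra ℂ Gen)) i j)

end FreeSkewField

/-- The skew field `ℂ(x, y)` of rational functions in two non-commuting variables, that is, the
universal field of fractions of `ℂ⟨x, y⟩`, built (following P. M. Cohn) as the universal
localization of `ℂ⟨x, y⟩` at the set of all full matrices. -/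
def FreeSkewField : Type := RingQuot FreeSkewField.Rel

namespace FreeSkewField

noncomputable instance : Ring FreeSkewField := inferInstanceAs (Ring (RingQuot Rel))

noncomputable instance : Algebra ℂ FreeSkewField := inferInstanceAs (Algebra ℂ (RingQuot Rel))

/-- The quotient map from the free algebra on all the generators. -/
noncomputable def mk : FreeAlgebra ℂ Gen →ₐ[ℂ] FreeSkewField := RingQuot.mkAlgHom ℂ Rel

/-- The canonical map `ℂ⟨x, y⟩ → ℂ(x, y)`. -/
noncomputable def ofPoly : NCPoly →ₐ[ℂ] FreeSkewField := mk.comp polyToFree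

theorem mk_eq {a b : FreeAlgebra ℂ Gen} (h : Rel a b) : mk a = mk b :=
  RingQuot.mkAlgHom_rel ℂ h

theorem map_mul_formalInv {n : ℕ} (A : Matrix (Fin n) (Fin n) NCPoly) (hA : IsFullMatrix A) :
    A.map ofPoly * (formalInv A hA).map mk = 1 := by
  ext i j
  have h := mk_eq (Rel.mul_inv A hA i j)
  rw [Matrix.mul_apply, map_sum] at h
  simp only [map_mul, Matrix.map_apply] at h
  rw [Matrix.mul_apply]
  simp only [Matrix.map_apply, ofPoly, AlgHom.comp_apply]
  rw [h, Matrix.one_apply, Matrix.one_apply]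
  split_ifs
  · exact map_one mk
  · exact map_zero mk

theorem formalInv_mul_map {n : ℕ} (A : Matrix (Fin n) (Fin n) NCPoly) (hA : IsFullMatrix A) :
    (formalInv A hA).map mk * A.map ofPoly = 1 := by
  ext i j
  have h := mk_eq (Rel.inv_mul A hA i j)
  rw [Matrix.mul_apply, map_sum] at h
  simp only [map_mul, Matrix.map_apply] at h
  rw [Matrix.mul_apply]
  simp only [Matrix.map_apply, ofPoly, AlgHom.comp_apply]
  rw [h, Matrix.one_apply, Matrix.one_apply]
  split_ifs
  · exact map_one mk
  · exact map_zero mk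

/-- Every nonzero polynomial is invertible in `ℂ(x, y)`. -/
theorem isUnit_ofPoly {p : NCPoly} (hp : p ≠ 0) : IsUnit (ofPoly p) := by
  have hA : IsFullMatrix (Matrix.of fun _ _ : Fin 1 => p) := by
    intro r P Q h
    by_contra hr
    obtain rfl : r = 0 := by omega
    apply hp
    have h0 := congrFun (congrFun h 0) 0
    rw [Matrix.mul_apply] at h0
    simpa using h0
  have h1 := congrFun (congrFun (map_mul_formalInv _ hA) 0) 0
  have h2 := congrFun (congrFun (formalInv_mul_map _ hA) 0) 0
  simp only [Matrix.mul_apply, Finset.univ_unique, Finset.sum_singleton, Matrix.map_apply,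
    Matrix.of_apply, Matrix.one_apply_eq] at h1 h2
  exact ⟨⟨_, _, h1, h2⟩, rfl⟩

/-- The variables, as invertible elements of `ℂ(x, y)`. -/
noncomputable def var (i : Fin 2) : FreeSkewFieldˣ :=
  (isUnit_ofPoly (FreeAlgebra.ι_ne_zero (R := ℂ) i)).unit

/-- The variable `x`. -/
noncomputable def x : FreeSkewFieldˣ := var 0

/-- The variable `y`. -/
noncomputable def y : FreeSkewFieldˣ := var 1

/-- The commutator `C = x y x⁻¹ y⁻¹`. -/
noncomputable def C : FreeSkewFieldˣ := x * y * x⁻¹ * y⁻¹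

end FreeSkewField

/-! ## The recursion, the Kontsevich map, and positive Laurent polynomials -/

/-- `R` satisfies the `(b, c)`-recursion: `R_{n+1} C R_{n-1}` is `1 + R_n ^ b` for odd `n` and
`1 + R_n ^ c` for even `n`. -/
def IsRecursionSolution {S : Type*} [Ring S] (b c : ℕ) (C : S) (R : ℤ → S) : Prop :=
  ∀ n : ℤ, (Odd n → R (n + 1) * C * R (n - 1) = 1 + R n ^ b) ∧
    (Even n → R (n + 1) * C * R (n - 1) = 1 + R n ^ c)

/-- `r` is a Laurent polynomial in `u, v` with non-negative integer coefficients: a finite linear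
combination, with coefficients in `ℕ`, of Laurent monomials, i.e. of words in `u, v, u⁻¹, v⁻¹`. -/
def IsPositiveLaurent {S : Type*} [Ring S] (u v : Sˣ) (r : S) : Prop :=
  ∃ p : FreeGroup (Fin 2) →₀ ℕ,
    r = p.sum fun w k => (k : S) * ((FreeGroup.lift ![u, v] w : Sˣ) : S)

/-- The map `T_a : (u, v) ↦ (u v u⁻¹, (1 + v ^ a) u⁻¹)`, meaningful when `u` is invertible. -/
noncomputable def kontsevichMap {S : Type*} [Ring S] (a : ℕ) (q : S × S) : S × S :=
  (q.1 * q.2 * Ring.inverse q.1, (1 + q.2 ^ a) * Ring.inverse q.1)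

/-! ### Positivity for noncommutative second-order linear recursions, and the conserved quantity. -/

section Positivity

variable {S : Type*} [Ring S]

/-! Let p be the terms that enter the recursion to the fourth power and q the others. The initial
data force `R (n + 1) * C * R n = R n * R (n + 1)` at one index, and the recursion carries this
relation to all indices. Then K = p_{k+1}² q_k⁻¹ + q_k⁻¹ p_k² does not depend on k, and p_{k+2} = K
p_{k+1} - C p_k, p_{k+2} C = p_{k+1} K - p_k (`conserved_quantity`).

The minus signs are harmless. K is a sum of Laurent monomials, and some product of two of them
equals C; hence the differences p_{k+1} - a p_k, where a is the ratio of the first two terms, obey a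
subtraction-free recursion (`mem_of_linear_recursion`). The q are recovered as p_k p_{k+1} - C⁻¹
(`right_product`), and C⁻¹ is again a summand of the product. Negative indices follow by reversing
the sequence in the opposite ring (`IsRecursionSolution.mem`).

Existence needs every 1 + R_n^a to be invertible. This is obtained from values at x = y = 1: all
terms are regular there with positive real value, and a regular element with nonzero value is
invertible (`IsRegular.exists_inverse`). Finally T_a maps (C R_{n-1}, R_n) to (C R_n, R_{n+1}) for
the exponent a attached to n, which gives the second claim. -/

/-- Solutions of a two-sided linear recursion with positive initial data are positive, and
consecutive terms have positive products, even after subtracting the constant `C⁻¹`. -/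
theorem mem_of_linear_recursion (M : Subsemiring S) (C : Sˣ) (p : ℕ → S) {a α β γ γ' δ d e : S}
    (hp : ∀ k, p (k + 2) = (a + (β + γ)) * p (k + 1) - C * p k)
    (hp' : ∀ k, p (k + 2) * C = p (k + 1) * (α + δ + (β + γ')) - p k)
    (h₁ : p 1 = a * p 0) (h₁' : p 1 * C = p 0 * (α + δ))
    (hαβ : α * ↑C⁻¹ * β = 1) (hd : (β + γ) * a = C + d) (he : p 1 * d * p 0 = ↑C⁻¹ + e)
    (hC : (↑C⁻¹ : S) ∈ M) (ha : a ∈ M) (hβ : β ∈ M) (hγ : γ ∈ M) (hγ' : γ' ∈ M)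
    (hδ : δ ∈ M) (hdM : d ∈ M) (heM : e ∈ M) (h₀ : p 0 ∈ M) :
    (∀ k, p k ∈ M) ∧ ∀ k, p (k + 1) * p (k + 2) - ↑C⁻¹ ∈ M := by
  -- With z_k = p_{k+1} - a p_k, the left recursion becomes z_{k+1} = (β + γ) z_k + d p_k, free of
  -- subtraction.
  have hz : ∀ k, p k ∈ M ∧ p (k + 1) - a * p k ∈ M := by
    intro k
    induction k with
    | zero => exact ⟨h₀, by rw [h₁, sub_self]; exact M.zero_mem⟩
    | succ k ih =>
      have e1 : p (k + 1 + 1) - a * p (k + 1)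
          = (β + γ) * (p (k + 1) - a * p k) + d * p k := by
        have : d = (β + γ) * a - C := by rw [hd]; abel
        rw [this, hp k]
        noncomm_ring
      refine ⟨?_, ?_⟩
      · have : p (k + 1) = a * p k + (p (k + 1) - a * p k) := by abel
        rw [this]
        exact M.add_mem (M.mul_mem ha ih.1) ih.2
      · rw [e1]
        exact M.add_mem (M.mul_mem (M.add_mem hβ hγ) ih.2) (M.mul_mem hdM ih.1)
  -- The right recursion is needed here: α C⁻¹ β = 1 turns positivity of p_{k+1} C - p_k (α + δ)
  -- into positivity of p_{k+1} β - p_k.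
  have hw : ∀ k, p (k + 1) * C - p k * (α + δ) ∈ M → p (k + 1) * β - p k ∈ M := by
    intro k ih
    have e1 : p (k + 1) * β - p k
        = p k * δ * ↑C⁻¹ * β + (p (k + 1) * C - p k * (α + δ)) * ↑C⁻¹ * β := by
      have h2 : p k * α * ↑C⁻¹ * β = p k := by
        rw [mul_assoc (p k), mul_assoc (p k), hαβ, mul_one]
      have h3 : p (k + 1) * C * ↑C⁻¹ * β = p (k + 1) * β := by
        rw [Units.mul_inv_cancel_right]
      calc p (k + 1) * β - p k = p (k + 1) * C * ↑C⁻¹ * β - p k * α * ↑C⁻¹ * β := by rw [h2, h3]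
        _ = _ := by simp only [mul_add, sub_mul, add_mul]; abel
    rw [e1]
    exact M.add_mem (M.mul_mem (M.mul_mem (M.mul_mem (hz k).1 hδ) hC) hβ)
      (M.mul_mem (M.mul_mem ih hC) hβ)
  have hz' : ∀ k, p (k + 1) * C - p k * (α + δ) ∈ M := by
    intro k
    induction k with
    | zero => rw [h₁', sub_self]; exact M.zero_mem
    | succ k ih =>
      have e1 : p (k + 1 + 1) * C - p (k + 1) * (α + δ)
          = (p (k + 1) * β - p k) + p (k + 1) * γ' := by
        rw [hp' k]
        noncomm_ring
      rw [e1]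
      exact M.add_mem (hw k ih) (M.mul_mem (hz _).1 hγ')
  have hz1 : ∀ k, p (k + 2) - a * p (k + 1)
      = (β + γ) * (p (k + 1) - a * p k) + d * p k := by
    intro k
    have : d = (β + γ) * a - C := by rw [hd]; abel
    rw [this, hp k]
    noncomm_ring
  -- C⁻¹ is present in p_1 z_1 = p_1 d p_0, and p_{k+1} z_{k+1} grows with k by elements of M only,
  -- since p_{k+2} β dominates p_{k+1}.
  have key : ∀ k, p (k + 1) * (p (k + 2) - a * p (k + 1)) - ↑C⁻¹ ∈ M := by
    intro k
    induction k with
    | zero =>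
      rw [hz1 0, h₁, sub_self, mul_zero, zero_add, ← h₁, ← mul_assoc, he, add_sub_cancel_left]
      exact heM
    | succ k ih =>
      have e1 : p (k + 1 + 1) * (p (k + 1 + 2) - a * p (k + 1 + 1)) - ↑C⁻¹
          = (p (k + 1) * (p (k + 2) - a * p (k + 1)) - ↑C⁻¹)
            + (p (k + 1 + 1) * β - p (k + 1)) * (p (k + 2) - a * p (k + 1))
            + p (k + 2) * γ * (p (k + 2) - a * p (k + 1))
            + p (k + 2) * d * p (k + 1) := by
        rw [hz1 (k + 1)]
        noncomm_ring
      rw [e1]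
      refine M.add_mem (M.add_mem (M.add_mem ih ?_) ?_) ?_
      · exact M.mul_mem (hw (k + 1) (hz' (k + 1))) (hz (k + 1)).2
      · exact M.mul_mem (M.mul_mem (hz _).1 hγ) (hz (k + 1)).2
      · exact M.mul_mem (M.mul_mem (hz _).1 hdM) (hz _).1
  refine ⟨fun k => (hz k).1, fun k => ?_⟩
  have e1 : p (k + 1) * p (k + 2) - ↑C⁻¹
      = p (k + 1) * a * p (k + 1) + (p (k + 1) * (p (k + 2) - a * p (k + 1)) - ↑C⁻¹) := by
    noncomm_ring
  rw [e1]
  exact M.add_mem (M.mul_mem (M.mul_mem (hz _).1 ha) (hz _).1) (key k)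

/-- Five consecutive terms `p, q, P, Q, T` of a solution, together with the quasi-commutation
relations, satisfy a two-sided linear recursion with coefficient `P² q⁻¹ + q⁻¹ p²`, and this
coefficient is conserved. -/
theorem conserved_quantity {C p q P Q T : Sˣ}
    (hPCq : (P * C * q : S) = q * P) (hQCP : (Q * C * P : S) = P * Q)
    (hP : (P * C * p : S) = 1 + q) (hQ : (Q * C * q : S) = 1 + P ^ 4)
    (hT : (T * C * P : S) = 1 + Q) :
    (T : S) = ((P : S) ^ 2 * ↑q⁻¹ + ↑q⁻¹ * p ^ 2) * P - C * p ∧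
    (T * C : S) = P * ((P : S) ^ 2 * ↑q⁻¹ + ↑q⁻¹ * p ^ 2) - p ∧
    (T : S) ^ 2 * ↑Q⁻¹ + ↑Q⁻¹ * P ^ 2 = (P : S) ^ 2 * ↑q⁻¹ + ↑q⁻¹ * p ^ 2 := by
  -- Quasi-commutation expresses C, hence p, Q and T, through P and q alone; the three identities
  -- are then checked on words in P, q and their inverses.
  have eC : C = P⁻¹ * q * P * q⁻¹ := by
    have : P * C * q = q * P := Units.ext (by simpa using hPCq)
    rw [eq_mul_inv_iff_mul_eq, mul_assoc P⁻¹, ← this]; group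
  have ep : (p : S) = q * ↑P⁻¹ * ↑q⁻¹ * (1 + q) := by
    rw [← hP, eC]; simp [mul_assoc]
  have eQ : (Q : S) = (1 + P ^ 4) * ↑P⁻¹ * ↑q⁻¹ * P := by
    rw [← hQ, eC]; simp [mul_assoc]
  have eT : (T : S) = (1 + Q) * ↑P⁻¹ * ↑C⁻¹ := by
    rw [← hT]; simp [mul_assoc]
  have eQT : (Q * T : S) = (1 + Q) * ↑P⁻¹ * Q := by
    have e1 : Q * C * P = P * Q := Units.ext (by simpa using hQCP)
    have e2 : (↑P⁻¹ * ↑C⁻¹ : S) = ↑Q⁻¹ * ↑P⁻¹ * Q := by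
      have : P⁻¹ * C⁻¹ = Q⁻¹ * P⁻¹ * Q := by
        rw [← mul_inv_rev, eq_comm, eq_inv_iff_mul_eq_one, mul_assoc (Q⁻¹ * P⁻¹),
          ← mul_assoc Q, e1]
        group
      exact_mod_cast congrArg Units.val this
    rw [eT, mul_assoc (1 + (Q : S)), e2]
    simp [mul_add, add_mul, mul_assoc]
  have h1 : (T : S) = ((P : S) ^ 2 * ↑q⁻¹ + ↑q⁻¹ * p ^ 2) * P - C * p := by
    rw [eT, ep, eQ, eC]
    simp only [mul_inv_rev, inv_inv, Units.val_mul]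
    simp only [mul_add, add_mul, mul_assoc, pow_succ, pow_zero, one_mul, mul_one,
      Units.mul_inv_cancel_left, Units.inv_mul_cancel_left, Units.mul_inv, Units.inv_mul]
    abel
  have h2 : (T * C : S) = P * ((P : S) ^ 2 * ↑q⁻¹ + ↑q⁻¹ * p ^ 2) - p := by
    rw [eT, ep, eQ, eC]
    simp only [mul_inv_rev, inv_inv, Units.val_mul]
    simp only [mul_add, add_mul, mul_assoc, pow_succ, pow_zero, one_mul, mul_one,
      Units.mul_inv_cancel_left, Units.inv_mul_cancel_left, Units.mul_inv, Units.inv_mul]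
    abel
  refine ⟨h1, h2, ?_⟩
  -- Q⁻¹ is not a Laurent polynomial in P, q; multiplying by Q on the left removes it, because Q T =
  -- (1 + Q) P⁻¹ Q.
  have h3 : (Q : S) * ((T : S) ^ 2 * ↑Q⁻¹ + ↑Q⁻¹ * P ^ 2)
      = (1 + Q) * ↑P⁻¹ * (1 + Q) * ↑P⁻¹ + P ^ 2 := by
    rw [mul_add, ← mul_assoc (Q : S), pow_two (T : S), ← mul_assoc (Q : S), eQT,
      mul_assoc _ (Q : S), eQT]
    simp [mul_assoc]
  refine Q.isUnit.mul_left_cancel ?_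
  rw [h3, ep, eQ]
  simp only [mul_add, add_mul, mul_assoc, pow_succ, pow_zero, one_mul, mul_one,
      Units.mul_inv_cancel_left, Units.inv_mul_cancel_left, Units.mul_inv, Units.inv_mul]
  abel

end Positivity

/-! ### Positivity in forward time, for the two kinds of initial pair. -/

section Positivity

set_option linter.unusedSimpArgs false

variable {S : Type*} [Ring S]

theorem linear_recursion_of_recursion {C : Sˣ} {p q : ℤ → Sˣ}
    (hp : ∀ k, (p (k + 1) * C * p k : S) = 1 + q k)
    (hq : ∀ k, (q (k + 1) * C * q k : S) = 1 + p (k + 1) ^ 4)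
    (hqp : ∀ k, (q k * C * p k : S) = p k * q k)
    (hpq : ∀ k, (p (k + 1) * C * q k : S) = q k * p (k + 1)) :
    ∀ k : ℕ, ((p (k + 2) : Sˣ) : S)
        = ((p 1 : S) ^ 2 * ↑(q 0)⁻¹ + ↑(q 0)⁻¹ * p 0 ^ 2) * p (k + 1) - C * p k ∧
      (p (k + 2) * C : S)
        = p (k + 1) * ((p 1 : S) ^ 2 * ↑(q 0)⁻¹ + ↑(q 0)⁻¹ * p 0 ^ 2) - p k := by
  have step : ∀ k : ℤ, _ := fun k => conserved_quantity (hpq k)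
    (hqp (k + 1)) (hp k) (hq k) (hp (k + 1))
  have hK : ∀ k : ℕ, (p (k + 1) : S) ^ 2 * ↑(q k)⁻¹ + ↑(q k)⁻¹ * p k ^ 2
      = (p 1 : S) ^ 2 * ↑(q 0)⁻¹ + ↑(q 0)⁻¹ * p 0 ^ 2 := by
    intro k
    induction k with
    | zero => simp
    | succ k ih => rw [← ih, ← (step k).2.2]; push_cast; rfl
  intro k
  have h := step k
  rw [hK k, add_assoc, one_add_one_eq_two] at h
  exact ⟨h.1, h.2.1⟩

/-- Both p P and q + C⁻¹ give p + p q when multiplied on the right by C p. -/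
theorem right_product {C p q P : Sˣ} (hqp : (q * C * p : S) = p * q)
    (hP : (P * C * p : S) = 1 + q) : (q : S) = p * P - ↑C⁻¹ := by
  have e : (C * p : S) = ↑q⁻¹ * p * q := by
    rw [mul_assoc, ← hqp]; simp [mul_assoc]
  have e' : (p * P * (C * p) : S) = (q + ↑C⁻¹) * (C * p) := by
    rw [mul_assoc, ← mul_assoc (P : S), hP, add_mul, ← mul_assoc (q : S), hqp,
      Units.inv_mul_cancel_left, mul_add, mul_one, add_comm]
  have h : (p * P : S) = q + ↑C⁻¹ := (C * p).isUnit.mul_right_cancel (by simpa using e')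
  rw [h, add_sub_cancel_right]

/-- Positivity when the initial data are `p 0, q 0`. -/
theorem mem_of_recursion_zero (M : Subsemiring S) {C : Sˣ} {p q : ℤ → Sˣ}
    (hp : ∀ k, (p (k + 1) * C * p k : S) = 1 + q k)
    (hq : ∀ k, (q (k + 1) * C * q k : S) = 1 + p (k + 1) ^ 4)
    (hqp : ∀ k, (q k * C * p k : S) = p k * q k)
    (hpq : ∀ k, (p (k + 1) * C * q k : S) = q k * p (k + 1))
    (hp0 : (p 0 : S) ∈ M) (hp0' : (↑(p 0)⁻¹ : S) ∈ M)
    (hq0 : (q 0 : S) ∈ M) (hq0' : (↑(q 0)⁻¹ : S) ∈ M) :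
    ∀ k : ℕ, (p k : S) ∈ M ∧ (q k : S) ∈ M := by
  have hlin := linear_recursion_of_recursion hp hq hqp hpq
  have eC : C = (q 0)⁻¹ * p 0 * q 0 * (p 0)⁻¹ := by
    have : q 0 * C * p 0 = p 0 * q 0 := Units.ext (by simpa using hqp 0)
    rw [eq_mul_inv_iff_mul_eq, mul_assoc (q 0)⁻¹, ← this]; group
  have hp1 : (p 1 : S) = (1 + ↑(q 0)⁻¹) * ↑(p 0)⁻¹ * q 0 := by
    have h := hp 0
    rw [zero_add] at h
    have : (p 1 : S) = (1 + q 0) * ↑(p 0)⁻¹ * ↑C⁻¹ := by rw [← h]; simp [mul_assoc]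
    rw [this, eC]
    simp [add_mul, mul_assoc, add_comm]
  have hr : ∀ k : ℕ, (q k : S) = p k * p (k + 1) - ↑C⁻¹ := fun k =>
    right_product (hqp k) (hp k)
  have hCM : (↑C⁻¹ : S) ∈ M := by
    rw [eC]
    simp only [mul_inv_rev, inv_inv, Units.val_mul]
    repeat first | assumption | exact M.one_mem | apply M.add_mem | apply M.mul_mem | apply M.pow_mem
  -- K = a + β + γ = α + δ + β + γ' are two groupings of K expanded in p 0, q 0, with a = p 1 (p
  -- 0)⁻¹. The product β a contains the word C, and d is (β + γ) a without it; likewise e is p 1 * d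
  -- * p 0 without the word C⁻¹.
  have main := mem_of_linear_recursion M C (fun k : ℕ => (p k : S))
    (a := (1 + ↑(q 0)⁻¹) * ↑(p 0)⁻¹ * q 0 * ↑(p 0)⁻¹) (α := ↑(p 0)⁻¹ * q 0 * ↑(p 0)⁻¹)
    (β := ↑(q 0)⁻¹ * p 0 ^ 2) (γ := ↑(p 0)⁻¹ ^ 2 + ↑(q 0)⁻¹ * ↑(p 0)⁻¹ ^ 2)
    (γ' := ↑(q 0)⁻¹ * ↑(p 0)⁻¹ ^ 2 + ↑(q 0)⁻¹ * ↑(p 0)⁻¹ * q 0 * ↑(p 0)⁻¹)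
    (δ := ↑(p 0)⁻¹ ^ 2)
    (d := ↑(q 0)⁻¹ * p 0 ^ 2 * ↑(q 0)⁻¹ * ↑(p 0)⁻¹ * q 0 * ↑(p 0)⁻¹
      + (↑(p 0)⁻¹ ^ 2 + ↑(q 0)⁻¹ * ↑(p 0)⁻¹ ^ 2)
        * ((1 + ↑(q 0)⁻¹) * ↑(p 0)⁻¹ * q 0 * ↑(p 0)⁻¹))
    (e := ↑(p 0)⁻¹ * q 0 * (↑(p 0)⁻¹ ^ 2 + ↑(q 0)⁻¹ * ↑(p 0)⁻¹ ^ 2)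
        * ((1 + ↑(q 0)⁻¹) * ↑(p 0)⁻¹ * q 0 * ↑(p 0)⁻¹) * p 0
      + ↑(q 0)⁻¹ * ↑(p 0)⁻¹ * q 0 * (↑(q 0)⁻¹ * p 0 ^ 2 * ↑(q 0)⁻¹ * ↑(p 0)⁻¹ * q 0 * ↑(p 0)⁻¹
      + (↑(p 0)⁻¹ ^ 2 + ↑(q 0)⁻¹ * ↑(p 0)⁻¹ ^ 2)
        * ((1 + ↑(q 0)⁻¹) * ↑(p 0)⁻¹ * q 0 * ↑(p 0)⁻¹)) * p 0)
    (fun k => ?_) (fun k => ?_) ?_ ?_ ?_ ?_ ?_ hCM ?_ ?_ ?_ ?_ ?_ ?_ ?_ ?_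
  · refine fun k => ⟨main.1 k, ?_⟩
    rcases k with - | k
    · exact hq0
    · rw [hr (k + 1)]
      have h := main.2 k
      push_cast at h ⊢
      rwa [add_assoc (k : ℤ), one_add_one_eq_two]
  · have h := (hlin k).1
    rw [hp1] at h
    push_cast
    rw [h, sub_left_inj]
    congr 1
    simp only [mul_add, add_mul, mul_assoc, pow_succ, pow_zero, one_mul, mul_one,
          Units.mul_inv_cancel_left, Units.inv_mul_cancel_left, Units.mul_inv, Units.inv_mul]
    abel
  · have h := (hlin k).2
    rw [hp1] at h
    push_cast
    rw [h, sub_left_inj]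
    congr 1
    simp only [mul_add, add_mul, mul_assoc, pow_succ, pow_zero, one_mul, mul_one,
          Units.mul_inv_cancel_left, Units.inv_mul_cancel_left, Units.mul_inv, Units.inv_mul]
    abel
  · push_cast
    rw [hp1]
    simp only [mul_add, add_mul, mul_assoc, pow_succ, pow_zero, one_mul, mul_one,
          Units.mul_inv_cancel_left, Units.inv_mul_cancel_left, Units.mul_inv, Units.inv_mul]
  · push_cast
    rw [hp1, eC]
    simp only [mul_inv_rev, inv_inv, Units.val_mul]
    simp only [mul_add, add_mul, mul_assoc, pow_succ, pow_zero, one_mul, mul_one,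
          Units.mul_inv_cancel_left, Units.inv_mul_cancel_left, Units.mul_inv, Units.inv_mul]
  · rw [eC]
    simp only [mul_inv_rev, inv_inv, Units.val_mul]
    simp only [mul_add, add_mul, mul_assoc, pow_succ, pow_zero, one_mul, mul_one,
          Units.mul_inv_cancel_left, Units.inv_mul_cancel_left, Units.mul_inv, Units.inv_mul]
  · rw [eC]
    simp only [mul_inv_rev, inv_inv, Units.val_mul]
    simp only [mul_add, add_mul, mul_assoc, pow_succ, pow_zero, one_mul, mul_one,
          Units.mul_inv_cancel_left, Units.inv_mul_cancel_left, Units.mul_inv, Units.inv_mul]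
    abel
  · push_cast
    rw [hp1, eC]
    simp only [mul_inv_rev, inv_inv, Units.val_mul]
    simp only [mul_add, add_mul, mul_assoc, pow_succ, pow_zero, one_mul, mul_one,
          Units.mul_inv_cancel_left, Units.inv_mul_cancel_left, Units.mul_inv, Units.inv_mul]
    abel
  all_goals repeat first | assumption | exact M.one_mem | apply M.add_mem | apply M.mul_mem | apply M.pow_mem

/-- Positivity when the initial data are `q 0, p 1`. -/
theorem mem_of_recursion_one (M : Subsemiring S) {C : Sˣ} {p q : ℤ → Sˣ}
    (hp : ∀ k, (p (k + 1) * C * p k : S) = 1 + q k)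
    (hq : ∀ k, (q (k + 1) * C * q k : S) = 1 + p (k + 1) ^ 4)
    (hqp : ∀ k, (q k * C * p k : S) = p k * q k)
    (hpq : ∀ k, (p (k + 1) * C * q k : S) = q k * p (k + 1))
    (hp0 : (p 1 : S) ∈ M) (hp0' : (↑(p 1)⁻¹ : S) ∈ M)
    (hq0 : (q 0 : S) ∈ M) (hq0' : (↑(q 0)⁻¹ : S) ∈ M) :
    ∀ k : ℕ, (p (k + 1) : S) ∈ M ∧ (q k : S) ∈ M := by
  have hlin := linear_recursion_of_recursion hp hq hqp hpq
  have hpq0 := hpq 0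
  have hp0r := hp 0
  rw [zero_add] at hpq0 hp0r
  have eC : C = (p 1)⁻¹ * q 0 * p 1 * (q 0)⁻¹ := by
    have : p 1 * C * q 0 = q 0 * p 1 := Units.ext (by simpa using hpq0)
    rw [eq_mul_inv_iff_mul_eq, mul_assoc (p 1)⁻¹, ← this]; group
  have ep : (p 0 : S) = q 0 * ↑(p 1)⁻¹ * ↑(q 0)⁻¹ * (1 + q 0) := by
    rw [← hp0r, eC]; simp [mul_assoc]
  have hr : ∀ k : ℕ, (q k : S) = p k * p (k + 1) - ↑C⁻¹ := fun k =>
    right_product (hqp k) (hp k)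
  have hCM : (↑C⁻¹ : S) ∈ M := by
    rw [eC]
    simp only [mul_inv_rev, inv_inv, Units.val_mul]
    repeat first | assumption | exact M.one_mem | apply M.add_mem | apply M.mul_mem | apply M.pow_mem
  have hq1 : (q 1 : S) = (1 + p 1 ^ 4) * ↑(p 1)⁻¹ * ↑(q 0)⁻¹ * p 1 := by
    have h := hq 0
    rw [zero_add] at h
    rw [← h, eC]; simp [mul_assoc]
  have hp2 : (p 2 : S) = (((p 1 : S) ^ 2 * ↑(q 0)⁻¹ + ↑(p 1)⁻¹ ^ 2 * ↑(q 0)⁻¹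
      + ↑(p 1)⁻¹ * q 0 * ↑(p 1)⁻¹ * ↑(q 0)⁻¹) * p 1) := by
    have h := hp 1
    rw [one_add_one_eq_two] at h
    have : (p 2 : S) = (1 + q 1) * ↑(p 1)⁻¹ * ↑C⁻¹ := by rw [← h]; simp [mul_assoc]
    rw [this, hq1, eC]
    simp only [mul_inv_rev, inv_inv, Units.val_mul]
    simp only [mul_add, add_mul, mul_assoc, pow_succ, pow_zero, one_mul, mul_one,
          Units.mul_inv_cancel_left, Units.inv_mul_cancel_left, Units.mul_inv, Units.inv_mul]
    abel
  -- The same scheme starting at p 1, with a = p 2 (p 1)⁻¹. It yields q only from index 2 on: q 0 is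
  -- given and q 1 is computed directly.
  have main := mem_of_linear_recursion M C (fun k : ℕ => (p (k + 1) : S))
    (a := (p 1 : S) ^ 2 * ↑(q 0)⁻¹ + ↑(p 1)⁻¹ ^ 2 * ↑(q 0)⁻¹
      + ↑(p 1)⁻¹ * q 0 * ↑(p 1)⁻¹ * ↑(q 0)⁻¹)
    (α := (p 1 : S) ^ 2 * ↑(q 0)⁻¹) (β := ↑(p 1)⁻¹ * q 0 * ↑(p 1)⁻¹) (γ := ↑(p 1)⁻¹ ^ 2)
    (γ' := ↑(p 1)⁻¹ * q 0 * ↑(p 1)⁻¹ * ↑(q 0)⁻¹)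
    (δ := ↑(p 1)⁻¹ ^ 2 + ↑(p 1)⁻¹ ^ 2 * ↑(q 0)⁻¹)
    (d := ↑(p 1)⁻¹ * q 0 * ↑(p 1)⁻¹ * (↑(p 1)⁻¹ ^ 2 * ↑(q 0)⁻¹
        + ↑(p 1)⁻¹ * q 0 * ↑(p 1)⁻¹ * ↑(q 0)⁻¹)
      + ↑(p 1)⁻¹ ^ 2 * ((p 1 : S) ^ 2 * ↑(q 0)⁻¹ + ↑(p 1)⁻¹ ^ 2 * ↑(q 0)⁻¹
        + ↑(p 1)⁻¹ * q 0 * ↑(p 1)⁻¹ * ↑(q 0)⁻¹))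
    (e := (p 1 : S) ^ 2 * ↑(q 0)⁻¹ * p 1 * (↑(p 1)⁻¹ * q 0 * ↑(p 1)⁻¹ * ↑(p 1)⁻¹ ^ 2 * ↑(q 0)⁻¹
        + ↑(p 1)⁻¹ ^ 2 * ((p 1 : S) ^ 2 * ↑(q 0)⁻¹ + ↑(p 1)⁻¹ ^ 2 * ↑(q 0)⁻¹
          + ↑(p 1)⁻¹ * q 0 * ↑(p 1)⁻¹ * ↑(q 0)⁻¹)) * p 1
      + (↑(p 1)⁻¹ ^ 2 * ↑(q 0)⁻¹ + ↑(p 1)⁻¹ * q 0 * ↑(p 1)⁻¹ * ↑(q 0)⁻¹) * p 1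
        * (↑(p 1)⁻¹ * q 0 * ↑(p 1)⁻¹ * (↑(p 1)⁻¹ ^ 2 * ↑(q 0)⁻¹
          + ↑(p 1)⁻¹ * q 0 * ↑(p 1)⁻¹ * ↑(q 0)⁻¹)
        + ↑(p 1)⁻¹ ^ 2 * ((p 1 : S) ^ 2 * ↑(q 0)⁻¹ + ↑(p 1)⁻¹ ^ 2 * ↑(q 0)⁻¹
          + ↑(p 1)⁻¹ * q 0 * ↑(p 1)⁻¹ * ↑(q 0)⁻¹)) * p 1)
    (fun k => ?_) (fun k => ?_) ?_ ?_ ?_ ?_ ?_ hCM ?_ ?_ ?_ ?_ ?_ ?_ ?_ ?_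
  · refine fun k => ⟨main.1 k, ?_⟩
    rcases k with - | - | k
    · exact hq0
    · push_cast
      rw [hq1]
      repeat first | assumption | exact M.one_mem | apply M.add_mem | apply M.mul_mem | apply M.pow_mem
    · rw [hr (k + 1 + 1)]
      have h := main.2 k
      push_cast at h ⊢
      rwa [add_assoc (k : ℤ) 2 1, add_comm (2 : ℤ) 1, ← add_assoc (k : ℤ) 1 2] at h
  · have h := (hlin (k + 1)).1
    rw [ep] at h
    push_cast at h ⊢
    rw [add_right_comm (k : ℤ) 2 1, h, sub_left_inj]
    congr 1
    simp only [mul_add, add_mul, mul_assoc, pow_succ, pow_zero, one_mul, mul_one,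
          Units.mul_inv_cancel_left, Units.inv_mul_cancel_left, Units.mul_inv, Units.inv_mul]
    abel
  · have h := (hlin (k + 1)).2
    rw [ep] at h
    push_cast at h ⊢
    rw [add_right_comm (k : ℤ) 2 1, h, sub_left_inj]
    congr 1
    simp only [mul_add, add_mul, mul_assoc, pow_succ, pow_zero, one_mul, mul_one,
          Units.mul_inv_cancel_left, Units.inv_mul_cancel_left, Units.mul_inv, Units.inv_mul]
    abel
  · push_cast
    rw [hp2]
  · push_cast
    rw [hp2, eC]
    simp only [mul_inv_rev, inv_inv, Units.val_mul]
    simp only [mul_add, add_mul, mul_assoc, pow_succ, pow_zero, one_mul, mul_one,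
          Units.mul_inv_cancel_left, Units.inv_mul_cancel_left, Units.mul_inv, Units.inv_mul]
    abel
  · rw [eC]
    simp only [mul_inv_rev, inv_inv, Units.val_mul]
    simp only [mul_add, add_mul, mul_assoc, pow_succ, pow_zero, one_mul, mul_one,
          Units.mul_inv_cancel_left, Units.inv_mul_cancel_left, Units.mul_inv, Units.inv_mul]
  · rw [eC]
    simp only [mul_inv_rev, inv_inv, Units.val_mul]
    simp only [mul_add, add_mul, mul_assoc, pow_succ, pow_zero, one_mul, mul_one,
          Units.mul_inv_cancel_left, Units.inv_mul_cancel_left, Units.mul_inv, Units.inv_mul]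
    abel
  · push_cast
    rw [hp2, eC]
    simp only [mul_inv_rev, inv_inv, Units.val_mul]
    simp only [mul_add, add_mul, mul_assoc, pow_succ, pow_zero, one_mul, mul_one,
          Units.mul_inv_cancel_left, Units.inv_mul_cancel_left, Units.mul_inv, Units.inv_mul]
    abel
  all_goals try push_cast
  all_goals repeat first | assumption | exact M.one_mem | apply M.add_mem | apply M.mul_mem | apply M.pow_mem

end Positivity

/-! ### Quasi-commutation along the sequence, time reversal, and Laurent polynomials as a
subsemiring. -/

section Reversal

variable {S : Type*} [Ring S]

/-- One step of propagation: A, B, D are consecutive terms, and D C A = 1 + B^a commutes with B. -/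
theorem quasi_commute_iff {G : Type*} [Group G] {A B D C : G} (h : Commute (D * C * A) B) :
    B * C * A = A * B ↔ D * C * B = B * D := by
  have h' : D * C * (A * B) = B * D * (C * A) := by simpa [mul_assoc] using h.eq
  constructor
  · intro e
    rw [← e, mul_assoc B, ← mul_assoc (D * C)] at h'
    exact mul_right_cancel h'
  · intro e
    rw [← e, mul_assoc (D * C) B] at h'
    rw [mul_assoc]
    exact (mul_left_cancel h').symm

theorem IsRecursionSolution.quasi_commute {b c : ℕ} {C : Sˣ} {R : ℤ → Sˣ}
    (hR : IsRecursionSolution b c (C : S) (fun n => (R n : S))) {m : ℤ}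
    (hm : R (m + 1) * C * R m = R m * R (m + 1)) (n : ℤ) :
    R (n + 1) * C * R n = R n * R (n + 1) := by
  have key : ∀ n : ℤ, R n * C * R (n - 1) = R (n - 1) * R n ↔
      R (n + 1) * C * R n = R n * R (n + 1) := by
    intro n
    refine quasi_commute_iff (Units.ext ?_)
    simp only [Units.val_mul]
    rcases Int.even_or_odd n with h | h
    · rw [(hR n).2 h]
      exact ((Commute.one_left _).add_left ((Commute.refl _).pow_left c)).eq
    · rw [(hR n).1 h]
      exact ((Commute.one_left _).add_left ((Commute.refl _).pow_left b)).eq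
  induction n using Int.inductionOn' (b := m) with
  | zero => exact hm
  | succ k _ ih =>
    have h := key (k + 1)
    rw [add_sub_cancel_right] at h
    exact h.1 ih
  | pred k _ ih =>
    rw [sub_add_cancel]
    exact (key k).2 ih

theorem IsRecursionSolution.shift {b c : ℕ} {C : S} {R : ℤ → S}
    (hR : IsRecursionSolution b c C R) : IsRecursionSolution c b C (fun n => R (n + 1)) := by
  intro n
  have h := hR (n + 1)
  have e : n + 1 - 1 = n - 1 + 1 := by ring
  rw [e] at h
  exact ⟨fun hn => h.2 hn.add_one, fun hn => h.1 hn.add_one⟩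

theorem IsRecursionSolution.mem_nat {b c : ℕ} (hbc : (b = 1 ∧ c = 4) ∨ (b = 4 ∧ c = 1))
    (M : Subsemiring S) {C : Sˣ} {R : ℤ → Sˣ}
    (hR : IsRecursionSolution b c (C : S) (fun n => (R n : S)))
    (hq : ∀ n, R (n + 1) * C * R n = R n * R (n + 1))
    (h0 : (R 0 : S) ∈ M) (h0' : (↑(R 0)⁻¹ : S) ∈ M)
    (h1 : (R 1 : S) ∈ M) (h1' : (↑(R 1)⁻¹ : S) ∈ M) (n : ℕ) : (R n : S) ∈ M := by
  have hq' : ∀ n, (R (n + 1) * C * R n : S) = R n * R (n + 1) := fun n => by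
    exact_mod_cast congrArg Units.val (hq n)
  rcases hbc with ⟨rfl, rfl⟩ | ⟨rfl, rfl⟩
  · have main := mem_of_recursion_zero M (C := C) (p := fun k => R (2 * k))
      (q := fun k => R (2 * k + 1)) (fun k => ?_) (fun k => ?_) (fun k => ?_) (fun k => ?_)
      (by simpa using h0) (by simpa using h0') (by simpa using h1) (by simpa using h1')
    · rcases Nat.even_or_odd' n with ⟨k, rfl | rfl⟩
      · exact_mod_cast (main k).1
      · exact_mod_cast (main k).2
    · have h := (hR (2 * k + 1)).1 ⟨k, rfl⟩
      simpa [mul_add, add_assoc] using h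
    · have h := (hR (2 * k + 2)).2 ⟨k + 1, by ring⟩
      have e : 2 * k + 2 - 1 = 2 * k + 1 := by ring
      rw [e] at h
      simpa [mul_add] using h
    · exact hq' (2 * k)
    · have h := hq' (2 * k + 1)
      simpa [mul_add, add_assoc] using h
  · have main := mem_of_recursion_one M (C := C) (p := fun k => R (2 * k - 1))
      (q := fun k => R (2 * k)) (fun k => ?_) (fun k => ?_) (fun k => ?_) (fun k => ?_)
      (by simpa using h1) (by simpa using h1') (by simpa using h0) (by simpa using h0')
    · rcases Nat.even_or_odd' n with ⟨k, rfl | rfl⟩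
      · exact_mod_cast (main k).2
      · have h := (main k).1
        have e : 2 * ((k : ℤ) + 1) - 1 = ((2 * k + 1 : ℕ) : ℤ) := by push_cast; ring
        rwa [e] at h
    · have h := (hR (2 * k)).2 ⟨k, by ring⟩
      have e : 2 * (k + 1) - 1 = 2 * k + 1 := by ring
      rw [e]
      simpa using h
    · have h := (hR (2 * k + 1)).1 ⟨k, rfl⟩
      have e : 2 * (k + 1) - 1 = 2 * k + 1 := by ring
      rw [e]
      simpa [mul_add, add_assoc] using h
    · have h := hq' (2 * k - 1)
      rwa [sub_add_cancel] at h
    · have h := hq' (2 * k)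
      have e : 2 * (k + 1) - 1 = 2 * k + 1 := by ring
      rwa [e]

open MulOpposite in
theorem IsRecursionSolution.mem {b c : ℕ} (hbc : (b = 1 ∧ c = 4) ∨ (b = 4 ∧ c = 1))
    (M : Subsemiring S) {C : Sˣ} {R : ℤ → Sˣ}
    (hR : IsRecursionSolution b c (C : S) (fun n => (R n : S)))
    (hq : ∀ n, R (n + 1) * C * R n = R n * R (n + 1))
    (h0 : (R 0 : S) ∈ M) (h0' : (↑(R 0)⁻¹ : S) ∈ M)
    (h1 : (R 1 : S) ∈ M) (h1' : (↑(R 1)⁻¹ : S) ∈ M) (n : ℤ) : (R n : S) ∈ M := by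
  obtain ⟨k, rfl | rfl⟩ := n.eq_nat_or_neg
  · exact hR.mem_nat hbc M hq h0 h0' h1 h1' k
  -- The reflection n ↦ 1 - n swaps the two initial terms and the parities, hence also b and c;
  -- passing to the opposite ring restores the order of the factors.
  let R' : ℤ → (Sᵐᵒᵖ)ˣ := fun n => Units.opEquiv.symm (op (R (1 - n)))
  have hR' : IsRecursionSolution c b ((Units.opEquiv.symm (op C) : (Sᵐᵒᵖ)ˣ) : Sᵐᵒᵖ)
      (fun n => (R' n : Sᵐᵒᵖ)) := by
    intro n
    have h := hR (1 - n)
    have e1 : 1 - n + 1 = 1 - (n - 1) := by ring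
    have e2 : 1 - n - 1 = 1 - (n + 1) := by ring
    rw [e1, e2] at h
    refine ⟨fun hn => ?_, fun hn => ?_⟩
    · have h' := congrArg op (h.2 (odd_one.sub_odd hn))
      simpa [R', mul_assoc] using h'
    · have h' := congrArg op (h.1 (odd_one.sub_even hn))
      simpa [R', mul_assoc] using h'
  have hq' : ∀ n, R' (n + 1) * Units.opEquiv.symm (op C) * R' n = R' n * R' (n + 1) := by
    intro n
    have h := congrArg (fun u => Units.opEquiv.symm (op u)) (hq (-n))
    have e1 : -n + 1 = 1 - n := by ring
    have e2 : -n = 1 - (n + 1) := by ring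
    rw [e1, e2] at h
    simpa [R', mul_assoc] using h
  have hinv : ∀ u : Sˣ, ((Units.opEquiv.symm (op u))⁻¹ : (Sᵐᵒᵖ)ˣ) = op (↑u⁻¹ : S) := fun u => rfl
  have main := hR'.mem_nat (by tauto) M.op hq' (by simpa [R'] using h1)
    (by simpa [R', hinv] using h1') (by simpa [R'] using h0) (by simpa [R', hinv] using h0') (k + 1)
  simpa [R'] using main

/-- The subsemiring generated by `u, v` and their inverses consists of positive Laurent polynomials. -/
theorem isPositiveLaurent_of_mem_closure {u v : Sˣ} {r : S}
    (h : r ∈ Subsemiring.closure {(u : S), ↑u⁻¹, ↑v, ↑v⁻¹}) : IsPositiveLaurent u v r := by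
  -- Positive Laurent polynomials are the image of the semiring ℕ[F₂], so they are closed under sums
  -- and products.
  let φ : MonoidAlgebra ℕ (FreeGroup (Fin 2)) →ₐ[ℕ] S :=
    MonoidAlgebra.lift ℕ S _ ((Units.coeHom S).comp (FreeGroup.lift ![u, v]))
  have hφ : ∀ w, ((FreeGroup.lift ![u, v] w : Sˣ) : S) ∈ φ.toRingHom.rangeS := fun w =>
    ⟨MonoidAlgebra.of ℕ _ w, by simp [φ]⟩
  have hle : Subsemiring.closure {(u : S), ↑u⁻¹, ↑v, ↑v⁻¹} ≤ φ.toRingHom.rangeS := by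
    rw [Subsemiring.closure_le]
    rintro s (rfl | rfl | rfl | rfl)
    · simpa using hφ (FreeGroup.of 0)
    · simpa using hφ (FreeGroup.of 0)⁻¹
    · simpa using hφ (FreeGroup.of 1)
    · simpa using hφ (FreeGroup.of 1)⁻¹
  obtain ⟨p, rfl⟩ := hle h
  refine ⟨p.coeff, ?_⟩
  exact (MonoidAlgebra.lift_apply _ p).trans (by simp [nsmul_eq_mul])

end Reversal

/-! ### Rational functions regular at x = y = 1, via linear systems. -/

namespace FreeSkewField

open Matrix

/-- Evaluation of a polynomial at `x = y = 1`. -/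
noncomputable def evalOne : NCPoly →ₐ[ℂ] ℂ := FreeAlgebra.lift ℂ fun _ => 1

/-- A factorization through size r bounds the rank of the evaluated matrix by r. -/
theorem isFullMatrix_of_isUnit {n : ℕ} {A : Matrix (Fin n) (Fin n) NCPoly}
    (hA : IsUnit (A.map evalOne)) : IsFullMatrix A := by
  intro r P Q h
  have h1 : A.map evalOne = P.map evalOne * Q.map evalOne := by
    rw [h]
    exact Matrix.map_mul (f := evalOne.toRingHom)
  have h2 := Matrix.rank_of_isUnit _ hA
  rw [Fintype.card_fin, h1] at h2
  rw [← h2]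
  exact (Matrix.rank_mul_le_left _ _).trans (Matrix.rank_le_width _)

/-- The polynomials, with their images in `ℂ(x, y)` and their values at `x = y = 1`. -/
noncomputable def ofPolyProd : NCPoly →+* FreeSkewField × ℂ :=
  ofPoly.toRingHom.prod evalOne.toRingHom

theorem exists_inverse_map_ofPolyProd {ι : Type} [Fintype ι] [DecidableEq ι]
    {A : Matrix ι ι NCPoly} (hA : IsUnit (A.map evalOne)) :
    ∃ B : Matrix ι ι (FreeSkewField × ℂ),
      A.map ofPolyProd * B = 1 ∧ B * A.map ofPolyProd = 1 := by
  obtain ⟨B₂, h₂, h₂'⟩ := isUnit_iff_exists.1 hA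
  let e := Fintype.equivFin ι
  have hA' : IsUnit ((A.submatrix e.symm e.symm).map evalOne) := by
    have := hA.map (Matrix.reindexRingEquiv ℂ e)
    exact this
  have hf := isFullMatrix_of_isUnit hA'
  let B₁ := ((formalInv _ hf).map mk).submatrix e e
  have h₁ : A.map ofPoly * B₁ = 1 := by
    have := congrArg (Matrix.submatrix · e e) (map_mul_formalInv _ hf)
    rw [← Matrix.submatrix_mul_equiv _ _ e e e, Matrix.submatrix_one_equiv] at this
    rw [← this]
    congr 1
    ext i j
    simp
  have h₁' : B₁ * A.map ofPoly = 1 := by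
    have := congrArg (Matrix.submatrix · e e) (formalInv_mul_map _ hf)
    rw [← Matrix.submatrix_mul_equiv _ _ e e e, Matrix.submatrix_one_equiv] at this
    rw [← this]
    congr 1
    ext i j
    simp
  refine ⟨Matrix.of fun i j => (B₁ i j, B₂ i j), ?_, ?_⟩
  · ext i j
    · have := congrFun (congrFun h₁ i) j
      simp only [Matrix.mul_apply, Prod.fst_sum, Matrix.one_apply] at this ⊢
      rw [apply_ite Prod.fst]
      exact this
    · have := congrFun (congrFun h₂ i) j
      simp only [Matrix.mul_apply, Prod.snd_sum, Matrix.one_apply] at this ⊢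
      rw [apply_ite Prod.snd]
      exact this
  · ext i j
    · have := congrFun (congrFun h₁' i) j
      simp only [Matrix.mul_apply, Prod.fst_sum, Matrix.one_apply] at this ⊢
      rw [apply_ite Prod.fst]
      exact this
    · have := congrFun (congrFun h₂' i) j
      simp only [Matrix.mul_apply, Prod.snd_sum, Matrix.one_apply] at this ⊢
      rw [apply_ite Prod.snd]
      exact this

/-- `t = (a, l)`, where `a` is a rational function that is regular at `x = y = 1` and takes the
value `l` there, as witnessed by a linear system whose matrix is invertible at this point. -/
def IsRegular (t : FreeSkewField × ℂ) : Prop :=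
  ∃ (ι : Type) (_ : Fintype ι) (_ : DecidableEq ι) (A : Matrix ι ι NCPoly) (u v : ι → NCPoly)
    (w : ι → FreeSkewField × ℂ), IsUnit (A.map evalOne) ∧
      A.map ofPolyProd *ᵥ w = ofPolyProd ∘ v ∧ t = (ofPolyProd ∘ u) ⬝ᵥ w

theorem isRegular_ofPolyProd (p : NCPoly) : IsRegular (ofPolyProd p) := by
  refine ⟨Unit, inferInstance, inferInstance, 1, fun _ => 1, fun _ => p, fun _ => ofPolyProd p,
    ?_, ?_, ?_⟩
  · rw [Matrix.map_one _ (map_zero _) (map_one _)]; exact isUnit_one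
  · rw [Matrix.map_one _ (map_zero _) (map_one _), Matrix.one_mulVec]; rfl
  · simp [dotProduct]

theorem isUnit_map_fromBlocks {ι κ : Type} [Fintype ι] [DecidableEq ι] [Fintype κ] [DecidableEq κ]
    {A : Matrix ι ι NCPoly} {D : Matrix κ κ NCPoly} (B : Matrix ι κ NCPoly)
    (hA : IsUnit (A.map evalOne)) (hD : IsUnit (D.map evalOne)) :
    IsUnit ((fromBlocks A B 0 D).map evalOne) := by
  rw [Matrix.isUnit_iff_isUnit_det] at *
  rw [fromBlocks_map, Matrix.map_zero _ (map_zero _), det_fromBlocks_zero₂₁]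
  exact hA.mul hD

theorem IsRegular.add {s t : FreeSkewField × ℂ} (hs : IsRegular s) (ht : IsRegular t) :
    IsRegular (s + t) := by
  obtain ⟨ι, _, _, A, u, v, w, hA, hw, rfl⟩ := hs
  obtain ⟨κ, _, _, D, u', v', w', hD, hw', rfl⟩ := ht
  refine ⟨ι ⊕ κ, inferInstance, inferInstance, fromBlocks A 0 0 D, Sum.elim u u', Sum.elim v v',
    Sum.elim w w', isUnit_map_fromBlocks 0 hA hD, ?_, ?_⟩
  · rw [fromBlocks_map, fromBlocks_mulVec]
    simp [hw, hw', Sum.comp_elim]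
  · rw [Sum.comp_elim, sumElim_dotProduct_sumElim]

/-- If s = u · w and t = u' · w', the block system with corner -v u' is solved by (w t, w'). -/
theorem IsRegular.mul {s t : FreeSkewField × ℂ} (hs : IsRegular s) (ht : IsRegular t) :
    IsRegular (s * t) := by
  obtain ⟨ι, _, _, A, u, v, w, hA, hw, rfl⟩ := hs
  obtain ⟨κ, _, _, D, u', v', w', hD, hw', rfl⟩ := ht
  refine ⟨ι ⊕ κ, inferInstance, inferInstance, fromBlocks A (-vecMulVec v u') 0 D,
    Sum.elim u 0, Sum.elim 0 v',
    Sum.elim (fun i => w i * ((ofPolyProd ∘ u') ⬝ᵥ w')) w',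
    isUnit_map_fromBlocks _ hA hD, ?_, ?_⟩
  · rw [fromBlocks_map, fromBlocks_mulVec, Sum.comp_elim]
    congr 1
    · ext1 i
      have h1 := congrFun hw i
      simp only [mulVec, dotProduct, Function.comp_apply, Matrix.map_apply] at h1
      simp only [Function.comp_def, Sum.elim_inl, Sum.elim_inr, Pi.add_apply, mulVec, dotProduct,
        Matrix.map_apply, Matrix.neg_apply, vecMulVec_apply, map_neg, map_mul, neg_mul,
        Finset.sum_neg_distrib, Pi.zero_apply, map_zero]
      simp only [← mul_assoc, ← Finset.sum_mul]
      rw [h1]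
      simp only [mul_assoc, ← Finset.mul_sum, add_neg_cancel]
    · simp [hw', Function.comp_def]
  · simp [dotProduct, Finset.sum_mul, mul_assoc]

/-- Border A by the column v and the row u. By the Schur complement the determinant at x = y = 1 is
-det A times the value of t, and the last diagonal entry of the inverse is -t⁻¹. -/
theorem IsRegular.exists_inverse {t : FreeSkewField × ℂ} (ht : IsRegular t) (h0 : t.2 ≠ 0) :
    ∃ s, IsRegular s ∧ t * s = 1 ∧ s * t = 1 := by
  obtain ⟨ι, _, _, A, u, v, w, hA, hw, rfl⟩ := ht
  let W : Matrix ι Unit (FreeSkewField × ℂ) := replicateCol Unit w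
  let U := replicateRow Unit u
  let V := replicateCol Unit v
  have hW : A.map ofPolyProd * W = V.map ofPolyProd := by
    ext1 i j
    exact congrFun hw i
  have hUW : ∀ i j, (U.map ofPolyProd * W) i j = (ofPolyProd ∘ u) ⬝ᵥ w := fun i j => rfl
  let A' : Matrix (ι ⊕ Unit) (ι ⊕ Unit) NCPoly := fromBlocks A V U 0
  have hA' : IsUnit (A'.map evalOne) := by
    have hsnd : ∀ p, (ofPolyProd p).2 = evalOne p := fun p => rfl
    have hW₂ : A.map evalOne * W.map Prod.snd = V.map evalOne := by
      ext i j
      have := congrArg Prod.snd (congrFun (congrFun hW i) j)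
      simpa only [Matrix.mul_apply, Matrix.map_apply, Prod.snd_sum, Prod.snd_mul, hsnd] using this
    obtain ⟨_⟩ := hA.nonempty_invertible
    rw [Matrix.isUnit_iff_isUnit_det, fromBlocks_map, det_fromBlocks₁₁, ← hW₂,
      Matrix.map_zero _ (map_zero _), Matrix.mul_assoc, Matrix.invOf_mul_cancel_left, zero_sub,
      Matrix.det_unique (n := Unit)]
    refine ((Matrix.isUnit_iff_isUnit_det _).1 hA).mul (IsUnit.mk0 _ ?_)
    rw [Matrix.neg_apply, neg_ne_zero]
    convert h0
    rw [← hUW default default]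
    simp only [Matrix.mul_apply, Matrix.map_apply, Prod.snd_sum, Prod.snd_mul, hsnd]
  obtain ⟨B, hB, hB'⟩ := exists_inverse_map_ofPolyProd hA'
  obtain ⟨E, -, hE⟩ := exists_inverse_map_ofPolyProd hA
  have h1 := hB
  rw [← fromBlocks_toBlocks B, fromBlocks_map, fromBlocks_multiply, ← fromBlocks_one,
    fromBlocks_inj] at h1 hB'
  rw [Matrix.map_zero _ (map_zero _)] at h1 hB'
  obtain ⟨-, h12, -, h22⟩ := h1
  obtain ⟨-, -, h21', h22'⟩ := hB'
  rw [Matrix.zero_mul, add_zero] at h22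
  rw [Matrix.mul_zero, add_zero] at h22'
  have hB12 : B.toBlocks₁₂ = -(W * B.toBlocks₂₂) := by
    rw [← hW, Matrix.mul_assoc, ← Matrix.mul_add] at h12
    have := congrArg (E * ·) h12
    simp only [← Matrix.mul_assoc, hE, Matrix.one_mul, Matrix.mul_zero] at this
    exact eq_neg_of_add_eq_zero_left this
  rw [hB12, Matrix.mul_neg, ← Matrix.mul_assoc] at h22
  rw [← hW, ← Matrix.mul_assoc, eq_neg_of_add_eq_zero_left h21', Matrix.neg_mul,
    Matrix.mul_assoc] at h22'
  refine ⟨-B (Sum.inr ()) (Sum.inr ()), ⟨ι ⊕ Unit, inferInstance, inferInstance, A',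
    Sum.elim 0 (fun _ => -1), Sum.elim 0 (fun _ => 1), fun i => B i (Sum.inr ()), hA', ?_, ?_⟩,
    ?_, ?_⟩
  · ext1 i
    refine (congrFun (congrFun hB i) (Sum.inr ())).trans ?_
    rcases i with i | i
    · simp
    · simp
  · simp [dotProduct]
  · have := congrFun (congrFun h22 ()) ()
    rw [Matrix.neg_apply, Matrix.mul_apply, Fintype.sum_unique, hUW, ← mul_neg] at this
    exact this
  · have := congrFun (congrFun h22' ()) ()
    rw [Matrix.neg_apply, Matrix.mul_apply, Fintype.sum_unique, hUW, ← neg_mul] at this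
    exact this

end FreeSkewField

/-! ### Existence and uniqueness of two-sided solutions. -/

section Existence

theorem exists_bilateral_sequence {G : Type*} [Group G] (C x₀ x₁ : G) (f g : G → G) :
    ∃ R : ℤ → G, R 0 = x₀ ∧ R 1 = x₁ ∧ ∀ n : ℤ,
      (Odd n → R (n + 1) * C * R (n - 1) = f (R n)) ∧
      (Even n → R (n + 1) * C * R (n - 1) = g (R n)) := by
  -- E advances (R_{2k}, R_{2k+1}) by two indices; in a group this is reversible, so its integer
  -- powers give the whole sequence.
  let E : Equiv.Perm (G × G) :=
    { toFun := fun s => (f s.2 * s.1⁻¹ * C⁻¹, g (f s.2 * s.1⁻¹ * C⁻¹) * s.2⁻¹ * C⁻¹)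
      invFun := fun s => (C⁻¹ * s.1⁻¹ * f (C⁻¹ * s.2⁻¹ * g s.1), C⁻¹ * s.2⁻¹ * g s.1)
      left_inv := fun s => by simp [mul_assoc]
      right_inv := fun s => by simp [mul_assoc] }
  let s : ℤ → G × G := fun k => (E ^ k) (x₀, x₁)
  have hs : ∀ k, s (k + 1) = E (s k) := fun k => by
    simp only [s, add_comm k, zpow_add, zpow_one, Equiv.Perm.mul_apply]
  let R : ℤ → G := fun n => if Even n then (s (n / 2)).1 else (s (n / 2)).2
  have hR0 : ∀ k, R (2 * k) = (s k).1 := fun k => by simp [R]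
  have hR1 : ∀ k, R (2 * k + 1) = (s k).2 := fun k => by
    have : (2 * k + 1) / 2 = k := by omega
    simp [R, this]
  refine ⟨R, hR0 0, hR1 0, fun n => ⟨?_, ?_⟩⟩
  · rintro ⟨k, rfl⟩
    have e : 2 * k + 1 + 1 = 2 * (k + 1) := by ring
    rw [e, add_sub_cancel_right, hR0, hR0, hR1, hs]
    simp [E]
  · intro hn
    obtain ⟨k, rfl⟩ : ∃ k, n = 2 * (k + 1) := by
      obtain ⟨k, rfl⟩ := hn
      exact ⟨k - 1, by ring⟩
    have e : 2 * (k + 1) - 1 = 2 * k + 1 := by ring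
    rw [e, hR1, hR1, hR0, hs]
    simp [E]

/-- Only `R` is required to consist of units: at each step the factors to be cancelled already agree
with terms of `R`. -/
theorem IsRecursionSolution.eq_of_eq {S : Type*} [Ring S] {b c : ℕ} {C : Sˣ} {R : ℤ → Sˣ}
    {R' : ℤ → S} (hR : IsRecursionSolution b c (C : S) (fun n => (R n : S)))
    (hR' : IsRecursionSolution b c (C : S) R') {m : ℤ} (h₀ : R' m = R m)
    (h₁ : R' (m + 1) = R (m + 1)) (n : ℤ) : R' n = R n := by
  have key : ∀ n : ℤ, R' n = R n → R' (n + 1) * C * R' (n - 1) = R (n + 1) * C * R (n - 1) := by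
    intro n hn
    rcases Int.even_or_odd n with h | h
    · rw [(hR n).2 h, (hR' n).2 h, hn]
    · rw [(hR n).1 h, (hR' n).1 h, hn]
  suffices R' n = R n ∧ R' (n + 1) = R (n + 1) from this.1
  induction n using Int.inductionOn' (b := m) with
  | zero => exact ⟨h₀, h₁⟩
  | succ k _ ih =>
    refine ⟨ih.2, ?_⟩
    have h := key (k + 1) ih.2
    rw [add_sub_cancel_right, ih.1] at h
    exact C.isUnit.mul_right_cancel ((R k).isUnit.mul_right_cancel h)
  | pred k _ ih =>
    rw [sub_add_cancel]
    refine ⟨?_, ih.1⟩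
    have h := key k ih.1
    rw [ih.2] at h
    exact (R (k + 1) * C).isUnit.mul_left_cancel (by simpa using h)

end Existence

/-! ### Running the recursion inside the group of positive units. -/

namespace FreeSkewField

/-- The rational functions that are regular and positive at `x = y = 1`. -/
def positiveUnits : Subgroup FreeSkewFieldˣ where
  carrier := {u | ∃ r : ℝ, 0 < r ∧ IsRegular ((u : FreeSkewField), (r : ℂ))}
  one_mem' := ⟨1, one_pos, by
    have h := isRegular_ofPolyProd 1
    rw [map_one] at h
    rwa [Units.val_one, Complex.ofReal_one]⟩
  mul_mem' := by
    rintro u v ⟨r, hr, hu⟩ ⟨s, hs, hv⟩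
    exact ⟨r * s, mul_pos hr hs, by simpa using hu.mul hv⟩
  inv_mem' := by
    rintro u ⟨r, hr, hu⟩
    obtain ⟨⟨s, l⟩, hs, h, h'⟩ := hu.exists_inverse (by simpa using hr.ne')
    have h1 : (u : FreeSkewField) * s = 1 := congrArg Prod.fst h
    have h2 : (r : ℂ) * l = 1 := congrArg Prod.snd h
    refine ⟨r⁻¹, inv_pos.2 hr, ?_⟩
    rwa [Units.inv_eq_of_mul_eq_one_right h1, Complex.ofReal_inv, inv_eq_of_mul_eq_one_right h2]

theorem var_mem_positiveUnits (i : Fin 2) : var i ∈ positiveUnits := by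
  refine ⟨1, one_pos, ?_⟩
  have h := isRegular_ofPolyProd (FreeAlgebra.ι ℂ i)
  have e : ofPolyProd (FreeAlgebra.ι ℂ i) = ((var i : FreeSkewField), ((1 : ℝ) : ℂ)) := by
    ext
    · rfl
    · simp [ofPolyProd, evalOne]
  rwa [e] at h

/-- Positivity of the value r of u^a ensures 1 + r ≠ 0, whence 1 + u^a is invertible. -/
theorem exists_eq_one_add_pow (u : positiveUnits) (a : ℕ) :
    ∃ w : positiveUnits, ((w : FreeSkewFieldˣ) : FreeSkewField)
      = 1 + ((u : FreeSkewFieldˣ) : FreeSkewField) ^ a := by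
  obtain ⟨r, hr, h⟩ := (u ^ a).2
  have hr' : 0 < 1 + r := by positivity
  have h1 := isRegular_ofPolyProd 1
  rw [map_one] at h1
  have h2 := h1.add h
  obtain ⟨⟨s, l⟩, -, hs, hs'⟩ := h2.exists_inverse (by
    simp only [Prod.snd_add, Prod.snd_one]
    exact_mod_cast hr'.ne')
  have e1 := congrArg Prod.fst hs
  have e2 := congrArg Prod.fst hs'
  refine ⟨⟨⟨_, s, e1, e2⟩, 1 + r, hr', ?_⟩, ?_⟩
  · convert h2 using 1
    ext <;> simp
  · simp

theorem exists_solution (b c : ℕ) {x₀ x₁ : FreeSkewFieldˣ} (h₀ : x₀ ∈ positiveUnits)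
    (h₁ : x₁ ∈ positiveUnits) : ∃ R : ℤ → FreeSkewFieldˣ,
      IsRecursionSolution b c (C : FreeSkewField) (fun n => (R n : FreeSkewField)) ∧
      R 0 = x₀ ∧ R 1 = x₁ := by
  have hx : x ∈ positiveUnits := var_mem_positiveUnits 0
  have hy : y ∈ positiveUnits := var_mem_positiveUnits 1
  have hC : C ∈ positiveUnits := mul_mem (mul_mem (mul_mem hx hy) (inv_mem hx)) (inv_mem hy)
  choose f hf using fun u => exists_eq_one_add_pow u b
  choose g hg using fun u => exists_eq_one_add_pow u c
  obtain ⟨R, hR0, hR1, hR⟩ := exists_bilateral_sequence (⟨C, hC⟩ : positiveUnits)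
    ⟨x₀, h₀⟩ ⟨x₁, h₁⟩ f g
  refine ⟨fun n => R n, fun n => ⟨fun hn => ?_, fun hn => ?_⟩, congrArg _ hR0, congrArg _ hR1⟩
  · rw [← hf, ← (hR n).1 hn]
    simp
  · rw [← hg, ← (hR n).2 hn]
    simp

theorem exists_solution_of_index (b c : ℕ) {m : ℤ} (hm : m = 0 ∨ m = 1) :
    ∃ R : ℤ → FreeSkewFieldˣ,
      IsRecursionSolution b c (C : FreeSkewField) (fun n => (R n : FreeSkewField)) ∧
      C * R m = x ∧ R (m + 1) = y := by
  have hx : x ∈ positiveUnits := var_mem_positiveUnits 0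
  have hy : y ∈ positiveUnits := var_mem_positiveUnits 1
  have hC : C ∈ positiveUnits := mul_mem (mul_mem (mul_mem hx hy) (inv_mem hx)) (inv_mem hy)
  have hCx : C⁻¹ * x ∈ positiveUnits := mul_mem (inv_mem hC) hx
  rcases hm with rfl | rfl
  · obtain ⟨R, hR, h0, h1⟩ := exists_solution b c hCx hy
    exact ⟨R, hR, by rw [h0, mul_inv_cancel_left], by rw [zero_add, h1]⟩
  · obtain ⟨R, hR, h0, h1⟩ := exists_solution c b hCx hy
    -- Shifting by one index exchanges the parities, so the solution for (c, b) becomes one for (b,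
    -- c).
    refine ⟨fun n => R (n - 1), ?_, by simp [h0], by simp [h1]⟩
    intro n
    have h := hR (n - 1)
    have e : n + 1 - 1 = n - 1 + 1 := by ring
    simp only [e]
    exact ⟨fun hn => h.2 (hn.sub_odd odd_one), fun hn => h.1 (hn.sub_odd odd_one)⟩

end FreeSkewField

/-! ### Transfer to the pairs (C R_m, R_{m+1}) and to the Kontsevich map. -/

section Laurent

variable {S : Type*} [Ring S]

theorem mul_mul_eq_of_commutator {C x y A B : Sˣ} (hC : C = x * y * x⁻¹ * y⁻¹) (hA : C * A = x)
    (hB : B = y) : B * C * A = A * B := by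
  have hA' : A = C⁻¹ * x := by rw [← hA, inv_mul_cancel_left]
  rw [hA', hC, hB]
  group

theorem closure_mem {u v : Sˣ} :
    ((u : S) ∈ Subsemiring.closure {(u : S), ↑u⁻¹, ↑v, ↑v⁻¹} ∧
      (↑u⁻¹ : S) ∈ Subsemiring.closure {(u : S), ↑u⁻¹, ↑v, ↑v⁻¹}) ∧
    (v : S) ∈ Subsemiring.closure {(u : S), ↑u⁻¹, ↑v, ↑v⁻¹} ∧
      (↑v⁻¹ : S) ∈ Subsemiring.closure {(u : S), ↑u⁻¹, ↑v, ↑v⁻¹} := by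
  refine ⟨⟨?_, ?_⟩, ?_, ?_⟩ <;> exact Subsemiring.subset_closure (by simp)

theorem IsRecursionSolution.mem_closure {b c : ℕ} (hbc : (b = 1 ∧ c = 4) ∨ (b = 4 ∧ c = 1))
    {C : Sˣ} {R : ℤ → Sˣ} (hR : IsRecursionSolution b c (C : S) (fun n => (R n : S)))
    (hq : ∀ n, R (n + 1) * C * R n = R n * R (n + 1)) {m : ℤ} (hm : m = 0 ∨ m = 1) (n : ℤ) :
    (R n : S) ∈ Subsemiring.closure
      {((C * R m : Sˣ) : S), ↑(C * R m)⁻¹, ↑(R (m + 1)), ↑(R (m + 1))⁻¹} := by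
  obtain ⟨⟨hu, hu'⟩, hv, hv'⟩ := closure_mem (u := C * R m) (v := R (m + 1))
  set M := Subsemiring.closure {((C * R m : Sˣ) : S), ↑(C * R m)⁻¹, ↑(R (m + 1)), ↑(R (m + 1))⁻¹}
  -- R_m is conjugate to C R_m by R_{m+1}, so both pairs generate the same Laurent polynomials.
  have e : R m = R (m + 1) * (C * R m) * (R (m + 1))⁻¹ := by
    rw [← mul_assoc, hq, mul_inv_cancel_right]
  have h0 : (R m : S) ∈ M := by
    rw [e]
    exact M.mul_mem (M.mul_mem hv hu) hv'
  have h0' : (↑(R m)⁻¹ : S) ∈ M := by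
    rw [e, mul_inv_rev, mul_inv_rev, inv_inv]
    exact M.mul_mem hv (M.mul_mem hu' hv')
  rcases hm with rfl | rfl
  · exact hR.mem hbc M hq h0 h0' hv hv' n
  · have h := IsRecursionSolution.mem (R := fun n => R (n + 1)) (by tauto) M hR.shift
      (fun n => hq (n + 1)) h0 h0' hv hv' (n - 1)
    rwa [sub_add_cancel] at h

/-- Quasi-commutation says that conjugating B by C A gives C B; thus the map advances the sequence
by one index. -/
theorem kontsevichMap_eq {a : ℕ} {C A B D : Sˣ} (hq : B * C * A = A * B)
    (hD : (D * C * A : S) = 1 + B ^ a) :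
    kontsevichMap a (((C * A : Sˣ) : S), (B : S)) = (((C * B : Sˣ) : S), (D : S)) := by
  unfold kontsevichMap
  rw [Ring.inverse_unit, ← hD]
  refine Prod.ext ?_ ?_
  · have : C * A * B * (C * A)⁻¹ = C * B := by
      rw [mul_inv_eq_iff_eq_mul, mul_assoc, ← hq]
      simp only [mul_assoc]
    simpa only [Units.val_mul] using congrArg Units.val this
  · simp [mul_assoc]

theorem IsRecursionSolution.iterate_kontsevichMap {b c : ℕ} {C : Sˣ} {R : ℤ → Sˣ}
    (hR : IsRecursionSolution b c (C : S) (fun n => (R n : S)))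
    (hq : ∀ n, R (n + 1) * C * R n = R n * R (n + 1)) (k : ℕ) :
    (kontsevichMap c ∘ kontsevichMap b)^[k] (((C * R 0 : Sˣ) : S), (R 1 : S))
        = (((C * R (2 * k) : Sˣ) : S), (R (2 * k + 1) : S)) ∧
      kontsevichMap b (((C * R (2 * k) : Sˣ) : S), (R (2 * k + 1) : S))
        = (((C * R (2 * k + 1) : Sˣ) : S), (R (2 * k + 2) : S)) := by
  have hb : ∀ k : ℤ, kontsevichMap b (((C * R (2 * k) : Sˣ) : S), (R (2 * k + 1) : S))
      = (((C * R (2 * k + 1) : Sˣ) : S), (R (2 * k + 2) : S)) := fun k => by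
    have h := (hR (2 * k + 1)).1 ⟨k, rfl⟩
    rw [add_sub_cancel_right, add_assoc, one_add_one_eq_two] at h
    exact kontsevichMap_eq (hq _) h
  refine ⟨?_, hb k⟩
  induction k with
  | zero => simp
  | succ k ih =>
    have h := (hR (2 * k + 2)).2 ⟨k + 1, by ring⟩
    have h' := hq (2 * k + 1)
    have e : (2 * k + 2 : ℤ) - 1 = 2 * k + 1 := by ring
    have e' : (2 * k + 1 : ℤ) + 1 = 2 * k + 2 := by ring
    have e'' : (2 * ((k + 1 : ℕ) : ℤ)) = 2 * k + 2 := by push_cast; ring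
    rw [e] at h
    rw [e'] at h'
    rw [Function.iterate_succ_apply', ih, Function.comp_apply, hb k, e'']
    exact kontsevichMap_eq h' h

end Laurent

/-- The index `m` selects the initial data: `(C R_0, R_1)` for `m = 0`, `(C R_1, R_2)` for `m = 1`
are the free variables. -/
theorem mainTheorem1 (b c : ℕ) (hbc : (b = 1 ∧ c = 4) ∨ (b = 4 ∧ c = 1)) :
    (∀ m : ℤ, m = 0 ∨ m = 1 →
      ∃ R : ℤ → FreeSkewFieldˣ,
        (IsRecursionSolution b c (FreeSkewField.C : FreeSkewField)
            (fun n => (R n : FreeSkewField)) ∧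
          FreeSkewField.C * R m = FreeSkewField.x ∧ R (m + 1) = FreeSkewField.y) ∧
        (∀ R' : ℤ → FreeSkewField,
          IsRecursionSolution b c (FreeSkewField.C : FreeSkewField) R' →
          (FreeSkewField.C : FreeSkewField) * R' m = FreeSkewField.x →
          R' (m + 1) = FreeSkewField.y →
          ∀ n : ℤ, R' n = R n) ∧
        (∀ n : ℤ, IsPositiveLaurent FreeSkewField.x FreeSkewField.y (R n : FreeSkewField)) ∧
        (∀ n : ℤ,
          IsPositiveLaurent (FreeSkewField.C * R 0) (R 1) (R n : FreeSkewField) ∧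
          IsPositiveLaurent (FreeSkewField.C * R 1) (R 2) (R n : FreeSkewField))) ∧
    (∀ k : ℕ, ∀ q : FreeSkewField × FreeSkewField,
      q = (kontsevichMap c ∘ kontsevichMap b)^[k]
          ((FreeSkewField.x : FreeSkewField), (FreeSkewField.y : FreeSkewField)) →
      IsUnit q.1 ∧ IsUnit (kontsevichMap b q).1 ∧
        IsPositiveLaurent FreeSkewField.x FreeSkewField.y q.1 ∧
        IsPositiveLaurent FreeSkewField.x FreeSkewField.y q.2) := by

  refine ⟨fun m hm => ?_, fun k q hk => ?_⟩
  · obtain ⟨R, hR, hx, hy⟩ := FreeSkewField.exists_solution_of_index b c hm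
    have hq := hR.quasi_commute (mul_mul_eq_of_commutator rfl hx hy)
    refine ⟨R, ⟨hR, by exact_mod_cast congrArg Units.val hx, by rw [hy]⟩, fun R' hR' hx' hy' n => ?_,
      fun n => ?_, fun n => ⟨?_, ?_⟩⟩
    · refine hR.eq_of_eq hR' (FreeSkewField.C.isUnit.mul_left_cancel ?_) (by rw [hy', hy]) n
      rw [hx', ← hx, Units.val_mul]
    · have h := isPositiveLaurent_of_mem_closure (hR.mem_closure hbc hq hm n)
      rwa [hx, hy] at h
    · exact isPositiveLaurent_of_mem_closure (hR.mem_closure hbc hq (Or.inl rfl) n)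
    · exact isPositiveLaurent_of_mem_closure (hR.mem_closure hbc hq (Or.inr rfl) n)
  · obtain ⟨R, hR, hx, hy⟩ := FreeSkewField.exists_solution_of_index b c (Or.inl rfl)
    have hq := hR.quasi_commute (mul_mul_eq_of_commutator rfl hx hy)
    have hmem := hR.mem_closure hbc hq (Or.inl rfl)
    obtain ⟨h, h'⟩ := hR.iterate_kontsevichMap hq k
    rw [hx, hy] at hmem
    rw [zero_add] at hy
    rw [hx, hy] at h
    rw [h] at hk
    subst hk
    rw [h']
    -- The first entries of q and of its image under T_b are the elements inverted by T_b and T_c,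
    -- so `Ring.inverse` is never used at a non-unit.
    refine ⟨(FreeSkewField.C * R (2 * k)).isUnit, (FreeSkewField.C * R (2 * k + 1)).isUnit,
      isPositiveLaurent_of_mem_closure ?_, isPositiveLaurent_of_mem_closure (hmem _)⟩
    obtain ⟨⟨hu, hu'⟩, hv, hv'⟩ := closure_mem (u := FreeSkewField.x) (v := FreeSkewField.y)
    exact mul_mem (mul_mem (mul_mem (mul_mem hu hv) hu') hv') (hmem _)
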